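/- Let $N\ge 2$ and let $f\colon\mathbb{R}\to\mathbb{R}$ be a continuous function such that $f(t)>0$ for every $t<0$ and $f$ is nonincreasing on $(-\infty,0)$. Let $u$ be a weak $C^1$ solution of $$-\operatorname{div}\left(\frac{\nabla u}{\sqrt{1+|\nabla u|^2}}\right)\ge f(u)\quad\text{on }\mathbb{R}^N,$$ that is, $u\in C^1(\mathbb{R}^N)$ and $$\int_{\mathbb{R}^N}\frac{\nabla u\cdot\nabla\varphi}{\sqrt{1+|\nabla u|^2}}\,dx\ \ge\ \int_{\mathbb{R}^N} f(u)\,\varphi\,dx$$ for every nonnegative compactly supported $\varphi\in C^1(\mathbb{R}^N)$. Then $u(x)\ge 0$ for every $x\in\mathbb{R}^N$. -/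

import Mathlib

open MeasureTheory

/-- `u` is a weak `C¹` solution of `-div (A(|∇u|) ∇u) ≥ h` on the open set `Ω ⊆ ℝ^N`:
`u ∈ C¹(Ω)` and `∫_Ω A(|∇u|) ∇u · ∇φ ≥ ∫_Ω h φ` for every nonnegative `C¹` function `φ` with
compact support in `Ω`. For continuous `A` and `h` both integrands are continuous on `Ω` with compact
support in `Ω`, hence integrable. -/
def IsWeakC1Supersolution {N : ℕ} (A : ℝ → ℝ) (Ω : Set (EuclideanSpace ℝ (Fin N)))
    (h u : EuclideanSpace ℝ (Fin N) → ℝ) : Prop :=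
  ContDiffOn ℝ 1 u Ω ∧
    ∀ φ : EuclideanSpace ℝ (Fin N) → ℝ, ContDiff ℝ 1 φ → HasCompactSupport φ → tsupport φ ⊆ Ω →
      (∀ x, 0 ≤ φ x) →
        ∫ x in Ω, h x * φ x ≤
          ∫ x in Ω, inner ℝ (A ‖gradient u x‖ • gradient u x) (gradient φ x)

/-- The coefficient `A(t) = 1 / √(1 + t²)` of the mean curvature operator. -/
noncomputable def meanCurvatureCoeff (t : ℝ) : ℝ := 1 / √(1 + t ^ 2)

/-! If `u` is negative somewhere, pick `ε > 0` so that `w = σ(-u - ε)`, with `σ` the smooth step, is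
not identically zero. Test the inequality with `w η_r`, where `η_r` is the radial cutoff. The term
with `∇w` has a favourable sign, the flux has norm at most `1`, and `f(u) ≥ f(-ε) > 0` where `w >
0`. Hence `J(r) = ∫ w η_r` satisfies `f(-ε) J(r) ≤ K (J(r+1) - J(r-1))` (`integral_truncation_le`),
which forces geometric growth of `J`. But `w ≤ 1` bounds `J` by the volume of a ball, a
contradiction (`nonpos_of_geometric_growth_of_le_pow`). Using `√(1 + ‖x‖²)` in place of `‖x‖` keeps
the cutoff smooth at the origin and its argument 1-Lipschitz. -/

/-- The smooth radial cutoff equal to `1` where `√(1 + ‖x‖²) ≤ r` and to `0` where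
`r + 1 ≤ √(1 + ‖x‖²)`. -/
noncomputable def radialCutoff {N : ℕ} (r : ℝ) (x : EuclideanSpace ℝ (Fin N)) : ℝ :=
  Real.smoothTransition (r + 1 - √(1 + ‖x‖ ^ 2))

namespace Real.smoothTransition

theorem differentiable : Differentiable ℝ Real.smoothTransition :=
  (Real.smoothTransition.contDiff (n := 1)).differentiable one_ne_zero

theorem deriv_nonneg (t : ℝ) : 0 ≤ deriv Real.smoothTransition t :=
  Real.smoothTransition.monotone.deriv_nonneg

theorem deriv_eq_zero_of_notMem_Icc {t : ℝ} (ht : t ∉ Set.Icc (0 : ℝ) 1) :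
    deriv Real.smoothTransition t = 0 := by
  rw [Set.mem_Icc, not_and_or, not_le, not_le] at ht
  rcases ht with ht | ht
  · have h : Real.smoothTransition =ᶠ[nhds t] fun _ => 0 := by
      filter_upwards [Iio_mem_nhds ht] with s hs
      exact Real.smoothTransition.zero_of_nonpos (le_of_lt hs)
    rw [h.deriv_eq, deriv_const]
  · have h : Real.smoothTransition =ᶠ[nhds t] fun _ => 1 := by
      filter_upwards [Ioi_mem_nhds ht] with s hs
      exact Real.smoothTransition.one_of_one_le (le_of_lt hs)
    rw [h.deriv_eq, deriv_const]

theorem exists_deriv_le : ∃ K : ℝ, 0 < K ∧ ∀ t, deriv Real.smoothTransition t ≤ K := by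
  obtain ⟨C, hC⟩ := (isCompact_Icc (a := (0 : ℝ)) (b := 1)).exists_bound_of_continuousOn
    ((Real.smoothTransition.contDiff (n := 1)).continuous_deriv le_rfl).continuousOn
  refine ⟨max C 1, by positivity, fun t => ?_⟩
  by_cases ht : t ∈ Set.Icc (0 : ℝ) 1
  · exact (le_abs_self _).trans ((hC t ht).trans (le_max_left _ _))
  · rw [deriv_eq_zero_of_notMem_Icc ht]
    positivity

end Real.smoothTransition

/-! ### Radial cutoffs: gradient bound and volume growth -/

section radialCutoff

variable {N : ℕ}

theorem norm_le_sqrt_one_add_sq (x : EuclideanSpace ℝ (Fin N)) : ‖x‖ ≤ √(1 + ‖x‖ ^ 2) :=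
  Real.le_sqrt_of_sq_le (by linarith)

theorem contDiff_sqrt_one_add_norm_sq :
    ContDiff ℝ 1 fun x : EuclideanSpace ℝ (Fin N) => √(1 + ‖x‖ ^ 2) :=
  (contDiff_const.add (contDiff_norm_sq ℝ)).sqrt fun x => by positivity

theorem contDiff_radialCutoff (r : ℝ) :
    ContDiff ℝ 1 (radialCutoff r : EuclideanSpace ℝ (Fin N) → ℝ) :=
  Real.smoothTransition.contDiff.comp (contDiff_const.sub contDiff_sqrt_one_add_norm_sq)

theorem radialCutoff_nonneg (r : ℝ) (x : EuclideanSpace ℝ (Fin N)) : 0 ≤ radialCutoff r x :=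
  Real.smoothTransition.nonneg _

theorem radialCutoff_le_one (r : ℝ) (x : EuclideanSpace ℝ (Fin N)) : radialCutoff r x ≤ 1 :=
  Real.smoothTransition.le_one _

theorem radialCutoff_mono {r s : ℝ} (h : r ≤ s) (x : EuclideanSpace ℝ (Fin N)) :
    radialCutoff r x ≤ radialCutoff s x :=
  Real.smoothTransition.monotone (by linarith)

theorem radialCutoff_eq_zero {r : ℝ} {x : EuclideanSpace ℝ (Fin N)}
    (h : r + 1 ≤ √(1 + ‖x‖ ^ 2)) : radialCutoff r x = 0 :=
  Real.smoothTransition.zero_of_nonpos (by linarith)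

theorem radialCutoff_eq_one {r : ℝ} {x : EuclideanSpace ℝ (Fin N)}
    (h : √(1 + ‖x‖ ^ 2) ≤ r) : radialCutoff r x = 1 :=
  Real.smoothTransition.one_of_one_le (by linarith)

theorem radialCutoff_eq_zero_of_notMem_closedBall {r : ℝ} {x : EuclideanSpace ℝ (Fin N)}
    (h : x ∉ Metric.closedBall 0 (r + 1)) : radialCutoff r x = 0 := by
  rw [mem_closedBall_zero_iff, not_le] at h
  exact radialCutoff_eq_zero (h.le.trans (norm_le_sqrt_one_add_sq x))

theorem hasCompactSupport_radialCutoff (r : ℝ) :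
    HasCompactSupport (radialCutoff r : EuclideanSpace ℝ (Fin N) → ℝ) :=
  HasCompactSupport.intro (isCompact_closedBall 0 (r + 1))
    fun _ hx => radialCutoff_eq_zero_of_notMem_closedBall hx

theorem abs_fderiv_sqrt_one_add_norm_sq_le (x y : EuclideanSpace ℝ (Fin N)) :
    |fderiv ℝ (fun x : EuclideanSpace ℝ (Fin N) => √(1 + ‖x‖ ^ 2)) x y| ≤ ‖y‖ := by
  have hpos : 0 < √(1 + ‖x‖ ^ 2) := by positivity
  have h := ((hasStrictFDerivAt_norm_sq x).hasFDerivAt.const_add 1).sqrt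
    (by positivity : (1 : ℝ) + ‖x‖ ^ 2 ≠ 0)
  rw [h.fderiv]
  have h2 : |inner ℝ x y| ≤ √(1 + ‖x‖ ^ 2) * ‖y‖ := (abs_real_inner_le_norm x y).trans
    (mul_le_mul_of_nonneg_right (norm_le_sqrt_one_add_sq x) (norm_nonneg y))
  simp only [smul_apply, innerSL_apply_apply, smul_eq_mul, nsmul_eq_mul]
  have h3 : 1 / (2 * √(1 + ‖x‖ ^ 2)) * (((2 : ℕ) : ℝ) * inner ℝ x y)
      = inner ℝ x y / √(1 + ‖x‖ ^ 2) := by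
    push_cast
    field_simp
  rw [h3, abs_div, abs_of_pos hpos, div_le_iff₀ hpos, mul_comm]
  exact h2

/-- The gradient of the cutoff at radius `r` is supported where the cutoff at radius `r + 1`
equals `1` and the one at radius `r - 1` vanishes. -/
theorem abs_fderiv_radialCutoff_le {K : ℝ} (hK : ∀ t, deriv Real.smoothTransition t ≤ K)
    (r : ℝ) (x y : EuclideanSpace ℝ (Fin N)) :
    |fderiv ℝ (radialCutoff r) x y| ≤
      K * (radialCutoff (r + 1) x - radialCutoff (r - 1) x) * ‖y‖ := by
  have hg : HasFDerivAt (fun x : EuclideanSpace ℝ (Fin N) => r + 1 - √(1 + ‖x‖ ^ 2))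
      (-fderiv ℝ (fun x : EuclideanSpace ℝ (Fin N) => √(1 + ‖x‖ ^ 2)) x) x :=
    ((contDiff_sqrt_one_add_norm_sq.differentiable one_ne_zero) x).hasFDerivAt.const_sub _
  have h := (Real.smoothTransition.differentiable
    (r + 1 - √(1 + ‖x‖ ^ 2))).hasDerivAt.comp_hasFDerivAt x hg
  have h' : fderiv ℝ (radialCutoff r) x = _ := h.fderiv
  rw [h', smul_apply, neg_apply, smul_eq_mul, abs_mul,
    abs_neg, abs_of_nonneg (Real.smoothTransition.deriv_nonneg _)]
  refine mul_le_mul ?_ (abs_fderiv_sqrt_one_add_norm_sq_le x y) (abs_nonneg _) ?_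
  -- On the transition layer the difference of the two outer cutoffs is exactly `1 - 0`; off it the
  -- derivative vanishes.
  · by_cases ht : r + 1 - √(1 + ‖x‖ ^ 2) ∈ Set.Icc (0 : ℝ) 1
    · rw [radialCutoff_eq_one (by linarith [ht.1]), radialCutoff_eq_zero (by linarith [ht.2])]
      simpa using hK _
    · rw [Real.smoothTransition.deriv_eq_zero_of_notMem_Icc ht]
      exact mul_nonneg ((Real.smoothTransition.deriv_nonneg 0).trans (hK 0))
        (sub_nonneg.2 (radialCutoff_mono (by linarith) x))
  · exact mul_nonneg ((Real.smoothTransition.deriv_nonneg 0).trans (hK 0))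
      (sub_nonneg.2 (radialCutoff_mono (by linarith) x))

theorem integrable_mul_radialCutoff {g : EuclideanSpace ℝ (Fin N) → ℝ} (hg : Continuous g)
    (r : ℝ) : Integrable fun x => g x * radialCutoff r x :=
  (hg.mul (contDiff_radialCutoff r).continuous).integrable_of_hasCompactSupport
    (hasCompactSupport_radialCutoff r).mul_left

theorem integral_mul_radialCutoff_le {w : EuclideanSpace ℝ (Fin N) → ℝ}
    (hw0 : ∀ x, 0 ≤ w x) (hw1 : ∀ x, w x ≤ 1) {r : ℝ} (hr : 0 ≤ r + 1) :
    ∫ x, w x * radialCutoff r x ≤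
      (r + 1) ^ N * volume.real (Metric.ball (0 : EuclideanSpace ℝ (Fin N)) 1) := by
  have hvol : volume.real (Metric.closedBall (0 : EuclideanSpace ℝ (Fin N)) (r + 1)) =
      (r + 1) ^ N * volume.real (Metric.ball (0 : EuclideanSpace ℝ (Fin N)) 1) := by
    have := Measure.addHaar_real_closedBall (volume : Measure (EuclideanSpace ℝ (Fin N))) 0 hr
    rwa [finrank_euclideanSpace_fin] at this
  have hfin : volume (Metric.closedBall (0 : EuclideanSpace ℝ (Fin N)) (r + 1)) ≠ ⊤ :=
    measure_closedBall_lt_top.ne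
  have hint : Integrable (Set.indicator
      (Metric.closedBall (0 : EuclideanSpace ℝ (Fin N)) (r + 1)) fun _ => (1 : ℝ)) :=
    (integrable_indicator_iff Metric.isClosed_closedBall.measurableSet).2 (integrableOn_const hfin)
  rw [← hvol, ← integral_indicator_one Metric.isClosed_closedBall.measurableSet]
  refine integral_mono_of_nonneg
    (.of_forall fun x => mul_nonneg (hw0 x) (radialCutoff_nonneg r x)) hint
    (.of_forall fun x => ?_)
  by_cases hx : x ∈ Metric.closedBall (0 : EuclideanSpace ℝ (Fin N)) (r + 1)
  · simpa [Set.indicator_of_mem hx] using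
      mul_le_one₀ (hw1 x) (radialCutoff_nonneg r x) (radialCutoff_le_one r x)
  · simp [Set.indicator_of_notMem hx, radialCutoff_eq_zero_of_notMem_closedBall hx]

end radialCutoff

/-! ### Bounded flux of the mean curvature operator -/

theorem meanCurvatureCoeff_pos (t : ℝ) : 0 < meanCurvatureCoeff t := by
  unfold meanCurvatureCoeff
  positivity

theorem continuous_meanCurvatureCoeff : Continuous meanCurvatureCoeff :=
  continuous_const.div (by fun_prop) fun t => by positivity

theorem meanCurvatureCoeff_mul_self_le_one (t : ℝ) : meanCurvatureCoeff t * t ≤ 1 := by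
  unfold meanCurvatureCoeff
  rw [one_div, inv_mul_le_iff₀ (by positivity), mul_one]
  exact Real.le_sqrt_of_sq_le (by linarith)

theorem inner_smul_gradient_eq {N : ℕ} (a : ℝ) (u φ : EuclideanSpace ℝ (Fin N) → ℝ)
    (x : EuclideanSpace ℝ (Fin N)) :
    inner ℝ (a • gradient u x) (gradient φ x) = a * fderiv ℝ φ x (gradient u x) := by
  rw [real_inner_smul_left, real_inner_comm, gradient, InnerProductSpace.toDual_symm_apply]

theorem fderiv_gradient_self {N : ℕ} (u : EuclideanSpace ℝ (Fin N) → ℝ)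
    (x : EuclideanSpace ℝ (Fin N)) : fderiv ℝ u x (gradient u x) = ‖gradient u x‖ ^ 2 := by
  rw [← real_inner_self_eq_norm_sq]
  conv_rhs => enter [2]; rw [gradient]
  rw [InnerProductSpace.toDual_symm_apply]

theorem ContDiff.continuous_gradient {N : ℕ} {u : EuclideanSpace ℝ (Fin N) → ℝ}
    (hu : ContDiff ℝ 1 u) : Continuous (gradient u) :=
  (InnerProductSpace.toDual ℝ (EuclideanSpace ℝ (Fin N))).symm.continuous.comp
    (hu.continuous_fderiv one_ne_zero)

/-! ### Testing with the truncation of `-u` -/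

section truncation

variable {N : ℕ} {u : EuclideanSpace ℝ (Fin N) → ℝ} (ε : ℝ)

theorem contDiff_smoothTransition_neg_sub (hu : ContDiff ℝ 1 u) :
    ContDiff ℝ 1 fun x => Real.smoothTransition (-u x - ε) :=
  Real.smoothTransition.contDiff.comp (hu.neg.sub contDiff_const)

/-- The truncation is a nonincreasing function of `u`, so its gradient is a nonpositive multiple of
`∇u`. -/
theorem fderiv_smoothTransition_neg_sub_gradient_nonpos (hu : ContDiff ℝ 1 u)
    (x : EuclideanSpace ℝ (Fin N)) :
    fderiv ℝ (fun x => Real.smoothTransition (-u x - ε)) x (gradient u x) ≤ 0 := by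
  have hg : HasFDerivAt (fun x => -u x - ε) (-fderiv ℝ u x) x :=
    ((hu.differentiable one_ne_zero) x).hasFDerivAt.neg.sub_const ε
  have h := (Real.smoothTransition.differentiable (-u x - ε)).hasDerivAt.comp_hasFDerivAt x hg
  have h' : fderiv ℝ (fun x => Real.smoothTransition (-u x - ε)) x = _ := h.fderiv
  rw [h', smul_apply, neg_apply, fderiv_gradient_self,
    smul_eq_mul, mul_neg, neg_nonpos]
  exact mul_nonneg (Real.smoothTransition.deriv_nonneg _) (sq_nonneg _)

/-- By the product rule, the part with `∇w` is dropped by sign; in the part with `∇η_r` the factor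
`A(|∇u|)|∇u| ≤ 1` removes all dependence on the size of `∇u`. -/
theorem inner_meanCurvature_gradient_mul_radialCutoff_le {K : ℝ}
    (hK : ∀ t, deriv Real.smoothTransition t ≤ K) (hu : ContDiff ℝ 1 u) (r : ℝ)
    (x : EuclideanSpace ℝ (Fin N)) :
    inner ℝ (meanCurvatureCoeff ‖gradient u x‖ • gradient u x)
        (gradient (fun y => Real.smoothTransition (-u y - ε) * radialCutoff r y) x) ≤
      K * (Real.smoothTransition (-u x - ε) * radialCutoff (r + 1) x -
        Real.smoothTransition (-u x - ε) * radialCutoff (r - 1) x) := by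
  have hw := (contDiff_smoothTransition_neg_sub ε hu).differentiable one_ne_zero x
  have hη := (contDiff_radialCutoff (N := N) r).differentiable one_ne_zero x
  rw [inner_smul_gradient_eq, fderiv_fun_mul hw hη]
  simp only [add_apply, smul_apply, smul_eq_mul]
  have hneg := fderiv_smoothTransition_neg_sub_gradient_nonpos ε hu x
  have hη' := (le_abs_self _).trans (abs_fderiv_radialCutoff_le hK r x (gradient u x))
  set w := Real.smoothTransition (-u x - ε)
  have hw0 : 0 ≤ w := Real.smoothTransition.nonneg _
  have hA := meanCurvatureCoeff_pos ‖gradient u x‖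
  have hA1 := meanCurvatureCoeff_mul_self_le_one ‖gradient u x‖
  have hD : 0 ≤ K * (radialCutoff (r + 1) x - radialCutoff (r - 1) x) :=
    mul_nonneg ((Real.smoothTransition.deriv_nonneg 0).trans (hK 0))
      (sub_nonneg.2 (radialCutoff_mono (by linarith) x))
  set D := K * (radialCutoff (r + 1) x - radialCutoff (r - 1) x) with hDdef
  set A := meanCurvatureCoeff ‖gradient u x‖
  calc A * (w * fderiv ℝ (radialCutoff r) x (gradient u x) + radialCutoff r x * _)
      ≤ A * (w * (D * ‖gradient u x‖) + 0) := by
        gcongr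
        exact mul_nonpos_of_nonneg_of_nonpos (radialCutoff_nonneg r x) hneg
    _ = w * D * (A * ‖gradient u x‖) := by ring
    _ ≤ w * D * 1 := by gcongr
    _ = _ := by rw [hDdef]; ring

/-- Caccioppoli-type inequality for the superlevel truncation of `-u`: the operator has bounded
flux, so the mass of the truncation in a ball is controlled by its mass in a boundary layer. -/
theorem integral_truncation_le {f : ℝ → ℝ} (hf : Continuous f)
    (hf_anti : AntitoneOn f (Set.Iio 0))
    (hu : IsWeakC1Supersolution meanCurvatureCoeff Set.univ (fun x => f (u x)) u)
    {K : ℝ} (hK : ∀ t, deriv Real.smoothTransition t ≤ K) (hε : 0 < ε) (r : ℝ) :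
    f (-ε) * ∫ x, Real.smoothTransition (-u x - ε) * radialCutoff r x ≤
      K * ((∫ x, Real.smoothTransition (-u x - ε) * radialCutoff (r + 1) x) -
        ∫ x, Real.smoothTransition (-u x - ε) * radialCutoff (r - 1) x) := by
  obtain ⟨hC, hweak⟩ := hu
  rw [contDiffOn_univ] at hC
  have hw := contDiff_smoothTransition_neg_sub ε hC
  set w := fun x => Real.smoothTransition (-u x - ε)
  have hw0 : ∀ x, 0 ≤ w x := fun x => Real.smoothTransition.nonneg _
  have hφ : ContDiff ℝ 1 fun x => w x * radialCutoff r x := hw.mul (contDiff_radialCutoff r)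
  have hφs : HasCompactSupport fun x => w x * radialCutoff r x :=
    (hasCompactSupport_radialCutoff r).mul_left
  have hkey := hweak _ hφ hφs (Set.subset_univ _)
    fun x => mul_nonneg (hw0 x) (radialCutoff_nonneg r x)
  simp only [Measure.restrict_univ] at hkey
  have hint := fun s => integrable_mul_radialCutoff hw.continuous s
  calc f (-ε) * ∫ x, w x * radialCutoff r x
      = ∫ x, f (-ε) * (w x * radialCutoff r x) := (integral_const_mul _ _).symm
    _ ≤ ∫ x, f (u x) * (w x * radialCutoff r x) := by
        refine integral_mono ((hint r).const_mul _) ?_ fun x => ?_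
        · exact ((hf.comp hC.continuous).mul hφ.continuous).integrable_of_hasCompactSupport
            hφs.mul_left
        -- Either `w` vanishes, or `u x < -ε < 0` and monotonicity of `f` applies.
        · rcases le_or_gt (-u x) ε with h | h
          · have : w x = 0 := Real.smoothTransition.zero_of_nonpos (by linarith)
            simp [this]
          · exact mul_le_mul_of_nonneg_right
              (hf_anti (by simp; linarith) (by simpa using hε) (by linarith))
              (mul_nonneg (hw0 x) (radialCutoff_nonneg r x))
    _ ≤ _ := hkey
    _ ≤ ∫ x, K * (w x * radialCutoff (r + 1) x - w x * radialCutoff (r - 1) x) := by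
        refine integral_mono ?_ (((hint _).sub (hint _)).const_mul _)
          fun x => inner_meanCurvature_gradient_mul_radialCutoff_le ε hK hC r x
        have hgs : HasCompactSupport (gradient fun x => w x * radialCutoff r x) :=
          (hφs.fderiv ℝ).comp_left (map_zero _)
        refine Continuous.integrable_of_hasCompactSupport ?_ ?_
        · exact ((continuous_meanCurvatureCoeff.comp hC.continuous_gradient.norm).smul
            hC.continuous_gradient).inner hφ.continuous_gradient
        · refine hgs.mono fun x hx => ?_
          contrapose! hx
          simp only [Function.mem_support, not_not] at hx ⊢
          rw [hx, inner_zero_right]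
    _ = _ := by rw [integral_const_mul, integral_sub (hint _) (hint _)]

end truncation

/-- Iterating gives `I 0 ≤ C (n + 1)^N / q^n`, and the right side tends to `0`. -/
theorem nonpos_of_geometric_growth_of_le_pow {I : ℕ → ℝ} {q C : ℝ} (N : ℕ) (hq : 1 < q)
    (hgrow : ∀ n, q * I n ≤ I (n + 1)) (hle : ∀ n, I n ≤ C * ((n : ℝ) + 1) ^ N) : I 0 ≤ 0 := by
  have hpow : ∀ n, q ^ n * I 0 ≤ I n := by
    intro n
    induction n with
    | zero => simp
    | succ n ih =>
      calc q ^ (n + 1) * I 0 = q * (q ^ n * I 0) := by ring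
        _ ≤ q * I n := by gcongr
        _ ≤ I (n + 1) := hgrow n
  -- The extra factor `q` compensates for shifting the exponent of `q` along with the base `n + 1`.
  have hlim := ((tendsto_pow_const_div_const_pow_of_one_lt N hq).comp
    (Filter.tendsto_add_atTop_nat 1)).const_mul (C * q)
  rw [mul_zero] at hlim
  refine ge_of_tendsto' hlim fun n => ?_
  have hqn : 0 < q ^ n := by positivity
  have h := (hpow n).trans (hle n)
  rw [← le_div_iff₀' hqn] at h
  refine h.trans (le_of_eq ?_)
  simp only [Function.comp_apply]
  push_cast
  field_simp
  ring

theorem mainTheorem3 (N : ℕ) (hN : 2 ≤ N) (f : ℝ → ℝ) (hf : Continuous f)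
    (hf_pos : ∀ t : ℝ, t < 0 → 0 < f t) (hf_anti : AntitoneOn f (Set.Iio 0))
    (u : EuclideanSpace ℝ (Fin N) → ℝ)
    (hu : IsWeakC1Supersolution meanCurvatureCoeff Set.univ (fun x => f (u x)) u) :
    ∀ x, 0 ≤ u x := by
  by_contra! ⟨x₀, hx₀⟩
  obtain ⟨K, hK0, hK⟩ := Real.smoothTransition.exists_deriv_le
  obtain ⟨ε, hε, hεx⟩ : ∃ ε, 0 < ε ∧ ε < -u x₀ := exists_between (by linarith)
  have hc : 0 < f (-ε) := hf_pos _ (by linarith)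
  have hw := (contDiff_smoothTransition_neg_sub ε (contDiffOn_univ.1 hu.1)).continuous
  have hcac := integral_truncation_le ε hf hf_anti hu hK hε
  have hint := fun s => integrable_mul_radialCutoff hw s
  have hle := fun {r : ℝ} => integral_mul_radialCutoff_le (N := N) (r := r)
    (fun x => Real.smoothTransition.nonneg (-u x - ε))
    (fun x => Real.smoothTransition.le_one (-u x - ε))
  have hmono : ∀ {r s : ℝ}, r ≤ s →
      ∫ x, Real.smoothTransition (-u x - ε) * radialCutoff r x ≤
        ∫ x, Real.smoothTransition (-u x - ε) * radialCutoff s x := fun h =>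
    integral_mono (hint _) (hint _) fun x =>
      mul_le_mul_of_nonneg_left (radialCutoff_mono h x) (Real.smoothTransition.nonneg _)
  have hpos : 0 < ∫ x, Real.smoothTransition (-u x - ε) * radialCutoff √(1 + ‖x₀‖ ^ 2) x := by
    refine (hw.mul (contDiff_radialCutoff _).continuous).integral_pos_of_hasCompactSupport_nonneg_nonzero
      (hasCompactSupport_radialCutoff _).mul_left
      (fun x => mul_nonneg (Real.smoothTransition.nonneg _) (radialCutoff_nonneg _ x))
      (x := x₀) ?_
    rw [radialCutoff_eq_one le_rfl, mul_one]
    exact (Real.smoothTransition.pos_of_pos (by linarith)).ne'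
  set r₀ := √(1 + ‖x₀‖ ^ 2)
  have hr₀ : 0 ≤ r₀ := Real.sqrt_nonneg _
  set J : ℝ → ℝ := fun r => ∫ x, Real.smoothTransition (-u x - ε) * radialCutoff r x
  refine hpos.not_ge ?_
  -- Radii advance by `2`, the gap between `r - 1` and `r + 1`. The constant `C` comes from `r₀ + 2n
  -- + 1 ≤ (r₀ + 2)(n + 1)`.
  have hres := nonpos_of_geometric_growth_of_le_pow (I := fun n : ℕ => J (r₀ + 2 * n))
    (q := 1 + f (-ε) / K)
    (C := (r₀ + 2) ^ N * volume.real (Metric.ball (0 : EuclideanSpace ℝ (Fin N)) 1)) N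
    (by linarith [div_pos hc hK0]) (fun n => ?_) (fun n => ?_)
  · simpa [J] using hres
  -- Apply the estimate at the middle radius, then bound `J` there below by its value at the inner
  -- radius.
  · have h1 := hcac (r₀ + 2 * n + 1)
    have h2 : J (r₀ + 2 * n) ≤ J (r₀ + 2 * n + 1) := hmono (by linarith)
    rw [add_sub_cancel_right, show r₀ + 2 * (n : ℝ) + 1 + 1 = r₀ + 2 * ((n + 1 : ℕ) : ℝ) by
      push_cast; ring] at h1
    have h3 : f (-ε) * J (r₀ + 2 * n) ≤ K * (J (r₀ + 2 * ((n + 1 : ℕ) : ℝ)) - J (r₀ + 2 * n)) :=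
      (mul_le_mul_of_nonneg_left h2 hc.le).trans h1
    rw [← div_le_iff₀' hK0] at h3
    have h4 : (1 + f (-ε) / K) * J (r₀ + 2 * n) =
      J (r₀ + 2 * n) + f (-ε) * J (r₀ + 2 * n) / K := by ring
    simp only [h4]
    linarith
  · refine (hle (by positivity)).trans ?_
    rw [mul_right_comm, ← mul_pow]
    have hn : (0 : ℝ) ≤ n := n.cast_nonneg
    gcongr
    nlinarith
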